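/- Let $n \ge 2$ be a natural number, let $1 \le k \le \infty$, and let $M \subset \mathbb{R}^n$ be open, endowed with its canonical structure of a manifold of class $C^k$. Write $\lambda^n$ for the Lebesgue measure on $\mathbb{R}^n$. A vector bundle over $M$ is a real vector bundle of locally finite (not necessarily constant) rank and of class $C^l$ for some $0 \le l \le k$. If $1 \le l$, a connection on such a bundle $E$ is a morphism of sheaves of abelian groups $\nabla \colon C^1(E) \to C^0(T^\vee(M) \otimes E)$ with $\nabla_U(fs) = df \otimes s + f\,\nabla_U(s)$ for all open $U \subset M$, $f \in C^1(U)$, $s \in C^1(U,E)$. It is of class $C^m$ if $m+1 \le l$ and $\nabla$ maps $C^l(E)$ into $C^m(T^\vee(M)\otimes E)$; in particular every connection is of class $C^0$. A section $s \in C^1(U,E)$ is $\nabla$-parallel if $\nabla_U(s) = 0$. A closed subset $F$ of $M$ is called negligible in $M$ for all connections of class $C^0$ if, for every vector bundle $E$ over $M$ and every connection $\nabla$ of class $C^0$ on $E$, every $\nabla$-parallel section of $E$ defined on $M \setminus F$ is the restriction of a $\nabla$-parallel section of $E$ defined on $M$. Then the following hold. 1. For every real number $\lambda_0 < \lambda^n(M)$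 there exists a compact subset $F$ of $M$ such that $\lambda_0 < \lambda^n(F)$ and $F$ is negligible in $M$ for all connections of class $C^0$. 2. If $\lambda^n(M) = \infty$, there exists a closed subset $F$ of $M$ such that $\lambda^n(F) = \infty$ and $F$ is negligible in $M$ for all connections of class $C^0$. -/

import Mathlib

open scoped ENNReal

universe u

namespace ParallelExtension

open TopologicalSpace

/-- `ℝⁿ` with its Euclidean structure; its `volume` is the Lebesgue measure. -/
abbrev RSpace (n : ℕ) : Type := EuclideanSpace ℝ (Fin n)

variable {n : ℕ} {M : Opens (RSpace n)}

/-- An open subset of the open submanifold `M` of `ℝⁿ`, viewed as a subset of `ℝⁿ`. -/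
def ambient (U : Opens M) : Set (RSpace n) := Subtype.val '' (U : Set M)

/-- A local trivialization, over an open subset `source` of `M`, of a family of real vector spaces
`Fiber` over `M`: a linear isomorphism of each fibre over `source` with `ℝ ^ rank`. -/
structure LocalTrivialization (M : Opens (RSpace n)) (Fiber : M → Type u)
    [∀ x, AddCommGroup (Fiber x)] [∀ x, Module ℝ (Fiber x)] where
  source : Opens M
  rank : ℕ
  equiv : ∀ x : M, x ∈ source → (Fiber x ≃ₗ[ℝ] (Fin rank → ℝ))

/-- A real vector bundle of class `C^l` over the open submanifold `M` of `ℝⁿ`, of locally finite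
(not necessarily constant) rank: a family of real vector spaces together with an atlas of local
trivializations whose sources cover `M` and whose transition functions are of class `C^l`.
(Mathlib's vector bundles have one model fibre, which would force the rank to be constant.) -/
structure VectBundle (M : Opens (RSpace n)) (l : ℕ∞) where
  Fiber : M → Type u
  [addCommGroup : ∀ x, AddCommGroup (Fiber x)]
  [module : ∀ x, Module ℝ (Fiber x)]
  atlas : Set (LocalTrivialization M Fiber)
  cover : ∀ x : M, ∃ φ ∈ atlas, x ∈ φ.source
  transition : ∀ φ ∈ atlas, ∀ ψ ∈ atlas,
    ∃ g : RSpace n → ((Fin φ.rank → ℝ) →L[ℝ] (Fin ψ.rank → ℝ)),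
      ContDiffOn ℝ l g (ambient (φ.source ⊓ ψ.source)) ∧
      ∀ (x : M) (hφ : x ∈ φ.source) (hψ : x ∈ ψ.source) (w : Fin φ.rank → ℝ),
        g x w = ψ.equiv x hψ ((φ.equiv x hφ).symm w)

attribute [instance] VectBundle.addCommGroup VectBundle.module

namespace VectBundle

variable {l : ℕ∞} (E : VectBundle.{u} M l)

/-- `C^m(U, E)`: the sections of class `C^m` in `E` defined on `U` (used for `m ≤ l`). These are
the set-theoretic sections that are of class `C^m` in every local trivialization of the atlas. -/
def sections (m : ℕ∞) (U : Opens M) : Submodule ℝ (∀ x : U, E.Fiber x) where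
  carrier := {s | ∀ φ ∈ E.atlas, ∃ g : RSpace n → (Fin φ.rank → ℝ),
    ContDiffOn ℝ m g (ambient (U ⊓ φ.source)) ∧
    ∀ (x : U) (hφ : (x : M) ∈ φ.source), g (x : M) = φ.equiv x hφ (s x)}
  add_mem' := by
    intro s t hs ht φ hφ
    obtain ⟨g, hg, hgs⟩ := hs φ hφ
    obtain ⟨h, hh, hht⟩ := ht φ hφ
    exact ⟨g + h, hg.add hh, fun x hx => by simp [hgs x hx, hht x hx]⟩
  zero_mem' := fun φ _ => ⟨0, contDiffOn_const, fun x hx => by simp⟩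
  smul_mem' := by
    intro c s hs φ hφ
    obtain ⟨g, hg, hgs⟩ := hs φ hφ
    exact ⟨c • g, hg.const_smul c, fun x hx => by simp [hgs x hx]⟩

/-- `C^m(U, T^∨(M) ⊗ E)` (used for `m ≤ l`). The cotangent space of `M ⊆ ℝⁿ` at a point is the dual
of `ℝⁿ`, and its tensor product with the fibre is the space of linear maps from `ℝⁿ` to the fibre.
Regularity is again regularity in every local trivialization. -/
def formSections (m : ℕ∞) (U : Opens M) : Submodule ℝ (∀ x : U, RSpace n →ₗ[ℝ] E.Fiber x) where
  carrier := {η | ∀ φ ∈ E.atlas, ∃ g : RSpace n → (RSpace n →L[ℝ] (Fin φ.rank → ℝ)),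
    ContDiffOn ℝ m g (ambient (U ⊓ φ.source)) ∧
    ∀ (x : U) (hφ : (x : M) ∈ φ.source) (v : RSpace n), g (x : M) v = φ.equiv x hφ (η x v)}
  add_mem' := by
    intro s t hs ht φ hφ
    obtain ⟨g, hg, hgs⟩ := hs φ hφ
    obtain ⟨h, hh, hht⟩ := ht φ hφ
    exact ⟨g + h, hg.add hh, fun x hx v => by simp [hgs x hx, hht x hx]⟩
  zero_mem' := fun φ _ => ⟨0, contDiffOn_const, fun x hx v => by simp⟩
  smul_mem' := by
    intro c s hs φ hφ
    obtain ⟨g, hg, hgs⟩ := hs φ hφ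
    exact ⟨c • g, hg.const_smul c, fun x hx v => by simp [hgs x hx]⟩

variable {E}

/-- Restriction of sections of class `C^m` in `E` to a smaller open set. -/
def restrict {m : ℕ∞} {U W : Opens M} (h : W ≤ U) (s : E.sections m U) : E.sections m W :=
  ⟨fun x => s.1 ⟨x, h x.2⟩, fun φ hφ => by
    obtain ⟨g, hg, hgs⟩ := s.2 φ hφ
    exact ⟨g, hg.mono (Set.image_mono (inf_le_inf_right φ.source h)),
      fun x hx => hgs ⟨x, h x.2⟩ hx⟩⟩

/-- Restriction of sections of class `C^m` in `T^∨(M) ⊗ E` to a smaller open set. -/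
def restrictForm {m : ℕ∞} {U W : Opens M} (h : W ≤ U) (η : E.formSections m U) :
    E.formSections m W :=
  ⟨fun x => η.1 ⟨x, h x.2⟩, fun φ hφ => by
    obtain ⟨g, hg, hgs⟩ := η.2 φ hφ
    exact ⟨g, hg.mono (Set.image_mono (inf_le_inf_right φ.source h)),
      fun x hx v => hgs ⟨x, h x.2⟩ hx v⟩⟩

/-- The product `f s` of a function `f` of class `C^m` on `U` and a section `s` of class `C^m`. The
function on `U` is represented by a function on `ℝⁿ` whose values outside `U` play no role. -/
def mulSection {m : ℕ∞} {U : Opens M} (f : RSpace n → ℝ) (hf : ContDiffOn ℝ m f (ambient U))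
    (s : E.sections m U) : E.sections m U :=
  ⟨fun x => f (x : M) • s.1 x, fun φ hφ => by
    obtain ⟨g, hg, hgs⟩ := s.2 φ hφ
    exact ⟨fun x => f x • g x, (hf.mono (Set.image_mono inf_le_left)).smul hg,
      fun x hx => by simp [hgs x hx]⟩⟩

end VectBundle

/-- A (linear) connection on a vector bundle `E` of class `C^l`, `1 ≤ l`: a morphism of sheaves of
abelian groups `∇ : C^1(E) → C^0(T^∨(M) ⊗ E)` that satisfies the Leibniz rule
`∇ (f s) = df ⊗ s + f ∇ s`. -/
structure Connection {l : ℕ∞} (E : VectBundle.{u} M l) where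
  one_le : 1 ≤ l
  toHom : ∀ U : Opens M, E.sections 1 U →+ E.formSections 0 U
  natural : ∀ (U W : Opens M) (h : W ≤ U) (s : E.sections 1 U),
    toHom W (VectBundle.restrict h s) = VectBundle.restrictForm h (toHom U s)
  leibniz : ∀ (U : Opens M) (f : RSpace n → ℝ) (hf : ContDiffOn ℝ (1 : ℕ∞) f (ambient U))
    (s : E.sections 1 U) (x : U) (v : RSpace n),
    (toHom U (VectBundle.mulSection f hf s)).1 x v =
      fderiv ℝ f (x : M) v • s.1 x + f (x : M) • (toHom U s).1 x v

namespace Connection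

variable {l : ℕ∞} {E : VectBundle.{u} M l} (D : Connection E)

/-- `Γ^∇(U, E)`: the group of `∇`-parallel sections in `E` defined on `U`. -/
def parallel (U : Opens M) : AddSubgroup (E.sections 1 U) := (D.toHom U).ker

/-- The connection is of class `C^m`: `m + 1 ≤ l`, and sections of class `C^l` in `E` are mapped to
sections of class `C^m` in `T^∨(M) ⊗ E`. -/
def IsOfClass (m : ℕ∞) : Prop :=
  m + 1 ≤ l ∧ ∀ (U : Opens M) (s : E.sections 1 U), s.1 ∈ E.sections l U →
    (D.toHom U s).1 ∈ E.formSections m U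

/-- The closed subset `F` of `M` is negligible in `M` for `(E, ∇)`: the restriction map
`Γ^∇(M, E) → Γ^∇(M \ F, E)` is surjective. -/
def IsNegligible (F : Closeds M) : Prop :=
  ∀ s ∈ D.parallel F.compl, ∃ t ∈ D.parallel ⊤, VectBundle.restrict le_top t = s

end Connection

/-- The closed subset `F` of the open submanifold `M` of `ℝⁿ`, where `M` carries its canonical
structure of a manifold of class `C^k`, is negligible in `M` for all connections of class `C^m`. The
vector bundles over a manifold of class `C^k` are those of class `C^l` with `l ≤ k`. -/
def IsNegligibleForClass (k m : ℕ∞) (M : Opens (RSpace n)) (F : Closeds M) : Prop :=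
  ∀ l : ℕ∞, l ≤ k → ∀ (E : VectBundle.{u} M l) (D : Connection E),
    D.IsOfClass m → D.IsNegligible F

end ParallelExtension

/-! Take a closed `K ⊆ ℝ` with dense complement and let `F` lie in `K ^ n`. Each hyperplane `x i =
c` with `c ∉ K` misses `K ^ n`, and since `n ≥ 2`, any two points off `K ^ n` are joined by three
segments in such hyperplanes, of total length at most `5 * ‖q - p‖` (`exists_slice_chain`). Thus `F`
may have large measure while its complement is quasiconvex at every scale.

In a trivialization a parallel section solves `dg = ∑ gᵢ ωᵢ` with continuous `ω`
(`exists_local_form`). Grönwall's inequality along the chains bounds `g` near a point of `K ^ n`;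
then `dg` is bounded, so the mean value inequality makes `g` Lipschitz and `g` extends continuously
to some `G`. The mean value inequality again, now comparing `dg` with its expected value at a point
of `K ^ n`, shows that `G` solves the same equation there (`exists_extension_of_powCompl`). Density
of the complement makes the local extensions unique, so they glue (`isNegligible_of_locally`).

For the measure, the complement of `K` is an open neighbourhood of `ℚ`, small for the coordinate
marginals of Lebesgue measure on a set of finite volume (`exists_powCompl_inter_lt`). For infinite
volume, such sets are placed in disjoint annuli; this is why thinness is only required locally. -/

namespace ParallelExtension

open TopologicalSpace Metric MeasureTheory

/-! ### Analysis off `K ^ n`: chains of segments, and extension of solutions of linear equations. -/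

section Slices

variable {n : ℕ} {K : Set ℝ}

/-- The complement of `K ^ n` in `ℝ ^ n`. -/
def powCompl (n : ℕ) (K : Set ℝ) : Set (RSpace n) := {x | ∃ i, x i ∉ K}

/-- Two points lie in a common hyperplane `x i = c` with `c ∉ K`; such a hyperplane is disjoint
from `K ^ n`. -/
def SliceRel (K : Set ℝ) (p q : RSpace n) : Prop := ∃ i, p i = q i ∧ p i ∉ K

theorem SliceRel.segment_subset {p q : RSpace n} (h : SliceRel K p q) :
    segment ℝ p q ⊆ powCompl n K := by
  obtain ⟨i, hi, hK⟩ := h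
  rintro _ ⟨a, b, -, -, hab, rfl⟩
  refine ⟨i, ?_⟩
  have : (a • p + b • q) i = p i := by
    simp only [PiLp.add_apply, PiLp.smul_apply, smul_eq_mul, ← hi]
    rw [← add_mul, hab, one_mul]
  rwa [this]

theorem dense_powCompl (hn : 0 < n) (hK : Dense Kᶜ) : Dense (powCompl n K) := by
  have hopen : IsOpenMap (fun x : RSpace n => x ⟨0, hn⟩) :=
    (EuclideanSpace.proj (𝕜 := ℝ) (⟨0, hn⟩ : Fin n)).isOpenMap fun c =>
      ⟨EuclideanSpace.single ⟨0, hn⟩ c, by simp⟩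
  exact (hK.preimage hopen).mono fun x hx => ⟨_, hx⟩

theorem isOpen_powCompl (hK : IsClosed K) : IsOpen (powCompl n K) := by
  have : powCompl n K = ⋃ i, (fun x : RSpace n => x i) ⁻¹' Kᶜ := by
    ext x; simp [powCompl]
  rw [this]
  exact isOpen_iUnion fun i => hK.isOpen_compl.preimage (by fun_prop)

/-- Two points off `K ^ n` are joined by a short chain of three segments off `K ^ n`. -/
theorem exists_slice_chain (hn : 2 ≤ n) (hK : Dense Kᶜ) {p q : RSpace n}
    (hp : p ∈ powCompl n K) (hq : q ∈ powCompl n K) :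
    ∃ a b : RSpace n, SliceRel K p a ∧ SliceRel K a b ∧ SliceRel K b q ∧
      ‖a - p‖ ≤ ‖q - p‖ ∧ ‖b - a‖ ≤ ‖q - p‖ ∧ ‖q - b‖ ≤ 3 * ‖q - p‖ := by
  -- Replacing the `j`-th coordinate of `a` by that of `q` keeps the `i`-th one, so `b` shares a
  -- good hyperplane with `a` and another with `q`.
  have key : ∀ (a : RSpace n) (i j : Fin n), i ≠ j → a i ∉ K → q j ∉ K →
      ∃ b : RSpace n, SliceRel K a b ∧ SliceRel K b q ∧ ‖b - a‖ = |(q - a) j| := by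
    intro a i j hij hi hj
    refine ⟨a + EuclideanSpace.single j (q j - a j), ⟨i, ?_, hi⟩, ⟨j, ?_, ?_⟩, ?_⟩
    · simp [hij]
    · simp
    · simpa using hj
    · simp
  obtain ⟨i, hi⟩ := hp
  obtain ⟨j, hj⟩ := hq
  by_cases hij : i = j
  · subst hij
    by_cases hpq : p = q
    · subst hpq
      exact ⟨p, p, ⟨i, rfl, hi⟩, ⟨i, rfl, hi⟩, ⟨i, rfl, hi⟩, by simp⟩
    have hd : 0 < ‖q - p‖ := norm_pos_iff.2 (sub_ne_zero.2 (Ne.symm hpq))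
    have : Nontrivial (Fin n) := Fin.nontrivial_iff_two_le.2 hn
    -- Only coordinate `i` is known to avoid `K` for both points. Inside the hyperplane through `p`,
    -- a second coordinate `m` is first moved off `K`, by less than `‖q - p‖`; then `key` applies to
    -- `m` and `i`.
    obtain ⟨m, hm⟩ := exists_ne i
    obtain ⟨c, hc, hcd⟩ := hK.exists_dist_lt (p m) hd
    set a : RSpace n := p + EuclideanSpace.single m (c - p m) with ha
    have hap : ‖a - p‖ ≤ ‖q - p‖ := by
      rw [dist_comm, Real.dist_eq] at hcd
      simpa [ha] using hcd.le
    have ham : a m ∉ K := by simpa [ha] using hc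
    have hai : a i = p i := by simp [ha, hm.symm]
    obtain ⟨b, hab, hbq, hb⟩ := key a m i hm ham hj
    have hba : ‖b - a‖ ≤ ‖q - p‖ := by
      rw [hb]
      have := PiLp.norm_apply_le (q - p) i
      simpa [hai] using this
    refine ⟨a, b, ⟨i, hai.symm, hi⟩, hab, hbq, hap, hba, ?_⟩
    have : q - b = (q - p) - (a - p) - (b - a) := by abel
    rw [this]
    linarith [norm_sub_le ((q - p) - (a - p)) (b - a), norm_sub_le (q - p) (a - p)]
  · obtain ⟨b, hab, hbq, hb⟩ := key p i j hij hi hj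
    have hba : ‖b - p‖ ≤ ‖q - p‖ := by
      rw [hb]
      exact PiLp.norm_apply_le (q - p) j
    refine ⟨p, b, ⟨i, rfl, hi⟩, hab, hbq, by simp, hba, ?_⟩
    have : q - b = (q - p) - (b - p) := by abel
    rw [this]
    linarith [norm_sub_le (q - p) (b - p), norm_nonneg (q - p)]

/-- The chain of `exists_slice_chain` stays inside a larger ball. -/
theorem exists_slice_chain_ball (hn : 2 ≤ n) (hK : Dense Kᶜ) {x₀ : RSpace n} {R : ℝ}
    {p q : RSpace n} (hp : p ∈ ball x₀ (R / 8) ∩ powCompl n K)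
    (hq : q ∈ ball x₀ (R / 8) ∩ powCompl n K) :
    ∃ a b : RSpace n, segment ℝ p a ⊆ ball x₀ R ∩ powCompl n K ∧
      segment ℝ a b ⊆ ball x₀ R ∩ powCompl n K ∧ segment ℝ b q ⊆ ball x₀ R ∩ powCompl n K ∧
      ‖a - p‖ ≤ ‖q - p‖ ∧ ‖b - a‖ ≤ ‖q - p‖ ∧ ‖q - b‖ ≤ 3 * ‖q - p‖ := by
  obtain ⟨a, b, h1, h2, h3, ha, hb, hc⟩ := exists_slice_chain hn hK hp.2 hq.2
  have hp0 := mem_ball_iff_norm.1 hp.1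
  have hq0 := mem_ball_iff_norm.1 hq.1
  have hR : 0 < R := by linarith [norm_nonneg (p - x₀)]
  -- Starting within `R / 8`, the distances from `x₀` to `a` and `b` stay below `3 * R / 8` and `5 *
  -- R / 8`.
  have hqp : ‖q - p‖ ≤ R / 4 := by
    have : q - p = (q - x₀) - (p - x₀) := by abel
    rw [this]
    linarith [norm_sub_le (q - x₀) (p - x₀)]
  have ha0 : ‖a - x₀‖ ≤ ‖a - p‖ + ‖p - x₀‖ := by
    have : a - x₀ = (a - p) + (p - x₀) := by abel
    rw [this]; exact norm_add_le _ _
  have hb0 : ‖b - x₀‖ ≤ ‖b - a‖ + ‖a - x₀‖ := by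
    have : b - x₀ = (b - a) + (a - x₀) := by abel
    rw [this]; exact norm_add_le _ _
  have pB : p ∈ ball x₀ R := mem_ball_iff_norm.2 (by linarith)
  have qB : q ∈ ball x₀ R := mem_ball_iff_norm.2 (by linarith)
  have aB : a ∈ ball x₀ R := mem_ball_iff_norm.2 (by linarith)
  have bB : b ∈ ball x₀ R := mem_ball_iff_norm.2 (by linarith)
  have hconv := convex_ball x₀ R
  exact ⟨a, b, Set.subset_inter (hconv.segment_subset pB aB) h1.segment_subset,
    Set.subset_inter (hconv.segment_subset aB bB) h2.segment_subset,
    Set.subset_inter (hconv.segment_subset bB qB) h3.segment_subset, ha, hb, hc⟩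

variable {V : Type*} [NormedAddCommGroup V] [NormedSpace ℝ V]

/-- Mean value inequality off `K ^ n`. -/
theorem norm_sub_sub_le_of_powCompl (hn : 2 ≤ n) (hK : Dense Kᶜ) {x₀ : RSpace n} {R ε : ℝ}
    {g : RSpace n → V} {g' : RSpace n → RSpace n →L[ℝ] V} {L : RSpace n →L[ℝ] V}
    (hg : ∀ x ∈ ball x₀ R ∩ powCompl n K, HasFDerivAt g (g' x) x)
    (hL : ∀ x ∈ ball x₀ R ∩ powCompl n K, ‖g' x - L‖ ≤ ε)
    {p q : RSpace n} (hp : p ∈ ball x₀ (R / 8) ∩ powCompl n K)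
    (hq : q ∈ ball x₀ (R / 8) ∩ powCompl n K) :
    ‖g q - g p - L (q - p)‖ ≤ 5 * ε * ‖q - p‖ := by
  obtain ⟨a, b, h1, h2, h3, ha, hb, hc⟩ := exists_slice_chain_ball hn hK hp hq
  have hε : 0 ≤ ε := (norm_nonneg _).trans (hL p (h1 (left_mem_segment ℝ p a)))
  have mvt : ∀ y z : RSpace n, segment ℝ y z ⊆ ball x₀ R ∩ powCompl n K →
      ‖g z - g y - L (z - y)‖ ≤ ε * ‖z - y‖ := fun y z h =>
    Convex.norm_image_sub_le_of_norm_hasFDerivWithin_le' (s := segment ℝ y z)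
      (fun x hx => (hg x (h hx)).hasFDerivWithinAt) (fun x hx => hL x (h hx))
      (convex_segment y z) (left_mem_segment ℝ y z) (right_mem_segment ℝ y z)
  -- The increments telescope along the chain; the constant 5 is `1 + 1 + 3`.
  have e : g q - g p - L (q - p) =
      (g a - g p - L (a - p)) + (g b - g a - L (b - a)) + (g q - g b - L (q - b)) := by
    simp only [map_sub]; abel
  rw [e]
  refine (norm_add₃_le).trans ?_
  have := mul_le_mul_of_nonneg_left ha hε
  have := mul_le_mul_of_nonneg_left hb hε
  have := mul_le_mul_of_nonneg_left hc hε
  linarith [mvt _ _ h1, mvt _ _ h2, mvt _ _ h3]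

/-- Grönwall's inequality on a segment. -/
theorem norm_le_exp_mul_of_segment {E : Type*} [NormedAddCommGroup E] [NormedSpace ℝ E]
    {g : E → V} {g' : E → E →L[ℝ] V} {C : ℝ} {y z : E}
    (hg : ∀ x ∈ segment ℝ y z, HasFDerivAt g (g' x) x)
    (hC : ∀ x ∈ segment ℝ y z, ‖g' x‖ ≤ C * ‖g x‖) :
    ‖g z‖ ≤ ‖g y‖ * Real.exp (C * ‖z - y‖) := by
  set c : ℝ → E := ⇑(AffineMap.lineMap y z : ℝ →ᵃ[ℝ] E) with hc
  have hcm : ∀ t ∈ Set.Icc (0 : ℝ) 1, c t ∈ segment ℝ y z := fun t ht =>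
    segment_eq_image_lineMap ℝ y z ▸ Set.mem_image_of_mem _ ht
  have hd : ∀ t ∈ Set.Icc (0 : ℝ) 1, HasDerivAt (g ∘ c) (g' (c t) (z - y)) t := fun t ht =>
    (hg _ (hcm t ht)).comp_hasDerivAt t AffineMap.hasDerivAt_lineMap
  have := norm_le_gronwallBound_of_norm_deriv_right_le (f := g ∘ c)
    (f' := fun t => g' (c t) (z - y)) (δ := ‖g y‖) (K := C * ‖z - y‖) (ε := 0) (a := 0) (b := 1)
    (fun t ht => (hd t ht).continuousAt.continuousWithinAt)
    (fun t ht => (hd t (Set.Ico_subset_Icc_self ht)).hasDerivWithinAt) (by simp [hc])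
    (fun t ht => by
      have h1 := (g' (c t)).le_opNorm (z - y)
      have h2 := mul_le_mul_of_nonneg_right (hC _ (hcm t (Set.Ico_subset_Icc_self ht)))
        (norm_nonneg (z - y))
      simp only [Function.comp]
      linarith)
    1 (by simp)
  simpa [hc, gronwallBound_ε0] using this

/-- Grönwall's inequality off `K ^ n`. -/
theorem norm_le_exp_mul_of_powCompl (hn : 2 ≤ n) (hK : Dense Kᶜ) {x₀ : RSpace n} {R C : ℝ}
    (hC0 : 0 ≤ C) {g : RSpace n → V} {g' : RSpace n → RSpace n →L[ℝ] V}
    (hg : ∀ x ∈ ball x₀ R ∩ powCompl n K, HasFDerivAt g (g' x) x)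
    (hC : ∀ x ∈ ball x₀ R ∩ powCompl n K, ‖g' x‖ ≤ C * ‖g x‖)
    {p q : RSpace n} (hp : p ∈ ball x₀ (R / 8) ∩ powCompl n K)
    (hq : q ∈ ball x₀ (R / 8) ∩ powCompl n K) :
    ‖g q‖ ≤ ‖g p‖ * Real.exp (C * (5 * ‖q - p‖)) := by
  obtain ⟨a, b, h1, h2, h3, ha, hb, hc⟩ := exists_slice_chain_ball hn hK hp hq
  have gr : ∀ y z : RSpace n, segment ℝ y z ⊆ ball x₀ R ∩ powCompl n K →
      ‖g z‖ ≤ ‖g y‖ * Real.exp (C * ‖z - y‖) := fun y z h =>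
    norm_le_exp_mul_of_segment (fun x hx => hg x (h hx)) (fun x hx => hC x (h hx))
  calc ‖g q‖ ≤ ‖g p‖ * Real.exp (C * ‖a - p‖) * Real.exp (C * ‖b - a‖) *
        Real.exp (C * ‖q - b‖) :=
        (gr _ _ h3).trans (by gcongr; exact (gr _ _ h2).trans (by gcongr; exact gr _ _ h1))
    _ = ‖g p‖ * Real.exp (C * (‖a - p‖ + ‖b - a‖ + ‖q - b‖)) := by
        rw [mul_add, mul_add, Real.exp_add, Real.exp_add]; ring
    _ ≤ _ := by gcongr; linarith

/-- The value `∑ wᵢ ωᵢ` at `x` of a family `ω` of vector-valued `1`-forms contracted with `w`. -/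
noncomputable def contract {r : ℕ} (ω : Fin r → RSpace n → RSpace n →L[ℝ] V) (x : RSpace n)
    (w : Fin r → ℝ) : RSpace n →L[ℝ] V := ∑ i, w i • ω i x

theorem norm_contract_le {r : ℕ} (ω : Fin r → RSpace n → RSpace n →L[ℝ] V) (x : RSpace n)
    (w : Fin r → ℝ) : ‖contract ω x w‖ ≤ (∑ i, ‖ω i x‖) * ‖w‖ := by
  rw [Finset.sum_mul]
  refine norm_sum_le_of_le _ fun i _ => ?_
  rw [norm_smul, mul_comm]
  gcongr
  exact norm_le_pi_norm w i

theorem ContinuousOn.contract {r : ℕ} {ω : Fin r → RSpace n → RSpace n →L[ℝ] V}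
    {U : Set (RSpace n)} (hω : ∀ i, ContinuousOn (ω i) U) {G : RSpace n → Fin r → ℝ}
    (hG : ContinuousOn G U) : ContinuousOn (fun x => contract ω x (G x)) U :=
  continuousOn_finsetSum _ fun i _ => (continuousOn_pi.1 hG i).smul (hω i)

/-- A solution, off `K ^ n`, of the linear total differential equation `dg = ∑ gᵢ ωᵢ` with continuous
coefficients extends, near every point, to a solution across `K ^ n`. -/
theorem exists_extension_of_powCompl (hn : 2 ≤ n) (hK : Dense Kᶜ) {r : ℕ} {U : Set (RSpace n)}
    (hU : IsOpen U) {x₀ : RSpace n} (hx₀ : x₀ ∈ U)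
    {ω : Fin r → RSpace n → RSpace n →L[ℝ] (Fin r → ℝ)} (hω : ∀ i, ContinuousOn (ω i) U)
    {g : RSpace n → Fin r → ℝ}
    (hg : ∀ x ∈ U ∩ powCompl n K, HasFDerivAt g (contract ω x (g x)) x) :
    ∃ ρ > 0, ball x₀ ρ ⊆ U ∧ ∃ G : RSpace n → Fin r → ℝ, ContDiffOn ℝ 1 G (ball x₀ ρ) ∧
      (∀ x ∈ ball x₀ ρ, HasFDerivAt G (contract ω x (G x)) x) ∧
      Set.EqOn G g (ball x₀ ρ ∩ powCompl n K) := by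
  have hn0 : 0 < n := by omega
  -- The `+ 1` leaves a strict margin at `x₀`, so by continuity `C` bounds the coefficients on a
  -- whole ball.
  set C : ℝ := ∑ i, ‖ω i x₀‖ + 1 with hCdef
  have hC0 : 0 ≤ C := by positivity
  obtain ⟨R, hR, hRU⟩ : ∃ R > 0, ball x₀ R ⊆ U ∩ {x | ∑ i, ‖ω i x‖ < C} := by
    refine Metric.mem_nhds_iff.1 (Filter.inter_mem (hU.mem_nhds hx₀) ?_)
    have : ContinuousAt (fun x => ∑ i, ‖ω i x‖) x₀ :=
      tendsto_finsetSum _ fun i _ => ((hω i).continuousAt (hU.mem_nhds hx₀)).norm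
    exact this.eventually_lt continuousAt_const (by simp [hCdef])
  have hgR : ∀ x ∈ ball x₀ R ∩ powCompl n K, HasFDerivAt g (contract ω x (g x)) x := fun x hx =>
    hg x ⟨(hRU hx.1).1, hx.2⟩
  have hCR : ∀ x ∈ ball x₀ R ∩ powCompl n K, ‖contract ω x (g x)‖ ≤ C * ‖g x‖ := fun x hx =>
    (norm_contract_le ω x _).trans (by gcongr; exact (hRU hx.1).2.le)
  obtain ⟨p, hp⟩ : (ball x₀ (R / 8) ∩ powCompl n K).Nonempty :=
    (dense_powCompl hn0 hK).inter_open_nonempty _ isOpen_ball ⟨x₀, mem_ball_self (by positivity)⟩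
  -- Grönwall from the fixed point `p` bounds `g`, so `S` bounds the derivative on the ball of
  -- radius `R / 8`.
  set S : ℝ := C * (‖g p‖ * Real.exp (C * (5 * R))) with hS
  have hS0 : 0 ≤ S := by positivity
  have hbd : ∀ x ∈ ball x₀ (R / 8) ∩ powCompl n K, ‖contract ω x (g x) - 0‖ ≤ S := by
    intro x hx
    have hxR : x ∈ ball x₀ R ∩ powCompl n K := ⟨ball_subset_ball (by linarith) hx.1, hx.2⟩
    have h1 := norm_le_exp_mul_of_powCompl hn hK hC0 hgR hCR hp hx
    have h2 : ‖x - p‖ ≤ R := by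
      have e : x - p = (x - x₀) - (p - x₀) := by abel
      have hx0 := mem_ball_iff_norm.1 hx.1
      have hp0 := mem_ball_iff_norm.1 hp.1
      rw [e]
      linarith [norm_sub_le (x - x₀) (p - x₀)]
    rw [sub_zero]
    refine (hCR x hxR).trans (mul_le_mul_of_nonneg_left (h1.trans ?_) hC0)
    gcongr
  -- Mean value inequality with `L = 0`; each use of the chains shrinks the radius by 8.
  have hlip : LipschitzOnWith ⟨5 * S, by positivity⟩ g (ball x₀ (R / 8 / 8) ∩ powCompl n K) := by
    refine lipschitzOnWith_iff_norm_sub_le.2 fun x hx y hy => ?_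
    have := norm_sub_sub_le_of_powCompl hn hK (L := 0)
      (fun z hz => hgR z ⟨ball_subset_ball (by linarith) hz.1, hz.2⟩) hbd hy hx
    rwa [zero_apply, sub_zero] at this
  obtain ⟨G, hGL, hG⟩ := hlip.extend_pi
  have hGc : Continuous G := hGL.continuous
  have hsub : ball x₀ (R / 8 / 8) ⊆ U := fun x hx =>
    (hRU (ball_subset_ball (by linarith) hx)).1
  have hcont : ContinuousOn (fun x => contract ω x (G x)) U := ContinuousOn.contract hω hGc.continuousOn
  have hder : ∀ x ∈ ball x₀ (R / 8 / 8), HasFDerivAt G (contract ω x (G x)) x := by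
    intro x hx
    rw [hasFDerivAt_iff_isLittleO, Asymptotics.isLittleO_iff]
    intro c hc
    -- The expected derivative varies by less than `c / 5` near `x`, and the chain constant 5 turns
    -- this into `c`.
    have hnear : ball x₀ (R / 8 / 8) ∩ {y | ‖contract ω y (G y) - contract ω x (G x)‖ < c / 5} ∈ nhds x := by
      refine Filter.inter_mem (isOpen_ball.mem_nhds hx) ?_
      have := ((hcont.continuousAt (hU.mem_nhds (hsub hx))).sub
        (continuousAt_const (y := contract ω x (G x)))).norm
      exact this.eventually_lt continuousAt_const (by simpa using hc)
    obtain ⟨δ, hδ, hδs⟩ := Metric.mem_nhds_iff.1 hnear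
    have hGδ : Set.EqOn g G (ball x δ ∩ powCompl n K) := fun y hy =>
      (hG ⟨(hδs hy.1).1, hy.2⟩)
    have hest : ∀ y ∈ ball x (δ / 8) ∩ powCompl n K, ∀ z ∈ ball x (δ / 8) ∩ powCompl n K,
        ‖G z - G y - contract ω x (G x) (z - y)‖ ≤ c * ‖z - y‖ := by
      intro y hy z hz
      have := norm_sub_sub_le_of_powCompl hn hK (x₀ := x) (R := δ) (ε := c / 5)
        (L := contract ω x (G x)) (fun w hw => hgR w
          ⟨ball_subset_ball (by linarith) (hδs hw.1).1, hw.2⟩)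
        (fun w hw => by rw [hGδ hw]; exact (hδs hw.1).2.le) hy hz
      have hsb : ball x (δ / 8) ⊆ ball x δ := ball_subset_ball (by linarith)
      rw [hGδ ⟨hsb hy.1, hy.2⟩, hGδ ⟨hsb hz.1, hz.2⟩] at this
      convert this using 2
      ring
    -- The estimate is closed in both points, so density carries it to base point `x`, then to all
    -- nearby `z`, including points of `K ^ n`.
    have hcl : ball x (δ / 8) ⊆ closure (ball x (δ / 8) ∩ powCompl n K) :=
      (dense_powCompl hn0 hK).open_subset_closure_inter isOpen_ball
    have hest1 : ∀ z ∈ ball x (δ / 8) ∩ powCompl n K,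
        ‖G z - G x - contract ω x (G x) (z - x)‖ ≤ c * ‖z - x‖ := by
      intro z hz
      refine (isClosed_le (f := fun y => ‖G z - G y - contract ω x (G x) (z - y)‖)
        (g := fun y => c * ‖z - y‖) (by fun_prop) (by fun_prop)).closure_subset_iff.2
        (fun y hy => hest y hy z hz) (hcl (mem_ball_self (by positivity)))
    filter_upwards [ball_mem_nhds x (show 0 < δ / 8 by positivity)] with z hz
    exact (isClosed_le (f := fun z => ‖G z - G x - contract ω x (G x) (z - x)‖)
      (g := fun z => c * ‖z - x‖) (by fun_prop) (by fun_prop)).closure_subset_iff.2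
      (fun y hy => hest1 y hy) (hcl hz)
  refine ⟨R / 8 / 8, by positivity, hsub, G, ?_, hder, fun x hx => (hG hx).symm⟩
  rw [show (1 : WithTop ℕ∞) = 0 + 1 by simp, contDiffOn_succ_iff_fderiv_of_isOpen isOpen_ball]
  refine ⟨fun x hx => (hder x hx).differentiableAt.differentiableWithinAt, by simp, ?_⟩
  rw [contDiffOn_zero]
  exact (hcont.mono hsub).congr fun x hx => (hder x hx).fderiv

end Slices

/-! ### Bundles and connections: local form, and gluing of parallel sections. -/

section Bundles

variable {n : ℕ} {M : Opens (RSpace n)}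

theorem isOpen_ambient (U : Opens M) : IsOpen (ambient U) :=
  M.isOpen.isOpenEmbedding_subtypeVal.isOpenMap _ U.isOpen

theorem mem_ambient {U : Opens M} {x : M} : (x : RSpace n) ∈ ambient U ↔ x ∈ U :=
  Subtype.val_injective.mem_set_image

variable {l : ℕ∞} {E : VectBundle.{u} M l}

namespace VectBundle

/-- A section with `C^m` coordinates in one trivialization of the atlas is of class `C^m`. -/
theorem mem_sections_of_coord {m : ℕ∞} (hm : m ≤ l) {φ : LocalTrivialization M E.Fiber}
    (hφ : φ ∈ E.atlas) {U : Opens M} (hU : U ≤ φ.source) {G : RSpace n → Fin φ.rank → ℝ}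
    (hG : ContDiffOn ℝ m G (ambient U)) :
    (fun x : U => (φ.equiv x (hU x.2)).symm (G (x : M))) ∈ E.sections m U := by
  intro ψ hψ
  obtain ⟨g, hg, hgt⟩ := E.transition φ hφ ψ hψ
  refine ⟨fun x => g x (G x), ?_, fun x hx => hgt x (hU x.2) hx _⟩
  refine ContDiffOn.clm_apply ?_ (hG.mono (Set.image_mono inf_le_left))
  exact (hg.mono (Set.image_mono (inf_le_inf_right ψ.source hU))).of_le (by exact_mod_cast hm)

/-- The section over `U` with given coordinates in a trivialization. -/
noncomputable def ofCoord {m : ℕ∞} (hm : m ≤ l) {φ : LocalTrivialization M E.Fiber}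
    (hφ : φ ∈ E.atlas) {U : Opens M} (hU : U ≤ φ.source) {G : RSpace n → Fin φ.rank → ℝ}
    (hG : ContDiffOn ℝ m G (ambient U)) : E.sections m U :=
  ⟨_, mem_sections_of_coord hm hφ hU hG⟩

/-- Being of class `C^m` is a local property. -/
theorem mem_sections_of_locally {m : ℕ∞} {U : Opens M} {s : ∀ x : U, E.Fiber x}
    (h : ∀ x : U, ∃ (W : Opens M) (hW : W ≤ U), (x : M) ∈ W ∧
      (fun y : W => s ⟨y, hW y.2⟩) ∈ E.sections m W) : s ∈ E.sections m U := by
  classical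
  intro φ hφ
  -- The value 0 outside `U ⊓ φ.source` is arbitrary: regularity is only required on that open set.
  let g : RSpace n → Fin φ.rank → ℝ := Function.extend (fun x : U => ((x : M) : RSpace n))
    (fun x => if hx : (x : M) ∈ φ.source then φ.equiv x hx (s x) else 0) 0
  have hg : ∀ (x : U) (hx : (x : M) ∈ φ.source), g (x : M) = φ.equiv x hx (s x) := by
    intro x hx
    have := (Subtype.val_injective.comp Subtype.val_injective).extend_apply
      (fun x : U => if hx : (x : M) ∈ φ.source then φ.equiv x hx (s x) else 0)
      (0 : RSpace n → Fin φ.rank → ℝ) x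
    exact this.trans (dif_pos hx)
  refine ⟨g, ?_, hg⟩
  rintro _ ⟨x, ⟨hxU, hxφ⟩, rfl⟩
  obtain ⟨W, hWU, hxW, hW⟩ := h ⟨x, hxU⟩
  obtain ⟨g', hg', hgW⟩ := hW φ hφ
  have hopen := isOpen_ambient (W ⊓ φ.source)
  have hx : (x : RSpace n) ∈ ambient (W ⊓ φ.source) := mem_ambient.2 ⟨hxW, hxφ⟩
  refine ((hg' x hx).contDiffAt (hopen.mem_nhds hx)).congr_of_eventuallyEq ?_ |>.contDiffWithinAt
  filter_upwards [hopen.mem_nhds hx]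
  rintro _ ⟨y, ⟨hyW, hyφ⟩, rfl⟩
  rw [hg ⟨y, hWU hyW⟩ hyφ, hgW ⟨y, hyW⟩ hyφ]

/-- Two sections that agree on a dense set agree. -/
theorem sections_eq_of_dense {m : ℕ∞} {W₁ W₂ : Opens M} (s₁ : E.sections m W₁)
    (s₂ : E.sections m W₂) {F : Set M} (hF : Dense Fᶜ)
    (h : ∀ (x : M) (h₁ : x ∈ W₁) (h₂ : x ∈ W₂), x ∉ F → s₁.1 ⟨x, h₁⟩ = s₂.1 ⟨x, h₂⟩)
    (x : M) (h₁ : x ∈ W₁) (h₂ : x ∈ W₂) : s₁.1 ⟨x, h₁⟩ = s₂.1 ⟨x, h₂⟩ := by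
  obtain ⟨φ, hφ, hx⟩ := E.cover x
  obtain ⟨g₁, hg₁, hs₁⟩ := s₁.2 φ hφ
  obtain ⟨g₂, hg₂, hs₂⟩ := s₂.2 φ hφ
  set O : Opens M := W₁ ⊓ W₂ ⊓ φ.source with hO
  have hc₁ : ContinuousOn (fun y : M => g₁ y) O :=
    hg₁.continuousOn.comp continuous_subtype_val.continuousOn
      fun y hy => mem_ambient.2 ⟨hy.1.1, hy.2⟩
  have hc₂ : ContinuousOn (fun y : M => g₂ y) O :=
    hg₂.continuousOn.comp continuous_subtype_val.continuousOn
      fun y hy => mem_ambient.2 ⟨hy.1.2, hy.2⟩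
  have heq : Set.EqOn (fun y : M => g₁ y) (fun y : M => g₂ y) (O ∩ Fᶜ) := by
    rintro y ⟨⟨⟨hy₁, hy₂⟩, hy⟩, hyF⟩
    simp only
    rw [hs₁ ⟨y, hy₁⟩ hy, hs₂ ⟨y, hy₂⟩ hy, h y hy₁ hy₂ hyF]
  have := heq.of_subset_closure hc₁ hc₂ Set.inter_subset_left
    (hF.open_subset_closure_inter O.isOpen) (show x ∈ O from ⟨⟨h₁, h₂⟩, hx⟩)
  simp only at this
  rw [hs₁ ⟨x, h₁⟩ hx, hs₂ ⟨x, h₂⟩ hx] at this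
  exact (φ.equiv x hx).injective this

end VectBundle

namespace Connection

open VectBundle

variable (D : Connection E)

/-- In a trivialization a connection is `d - ω` with a continuous matrix `ω` of `1`-forms. -/
theorem exists_local_form {φ : LocalTrivialization M E.Fiber} (hφ : φ ∈ E.atlas) :
    ∃ ω : Fin φ.rank → RSpace n → RSpace n →L[ℝ] (Fin φ.rank → ℝ),
      (∀ i, ContinuousOn (ω i) (ambient φ.source)) ∧
      ∀ (U : Opens M) (hU : U ≤ φ.source) (s : E.sections 1 U) (g : RSpace n → Fin φ.rank → ℝ),
        ContDiffOn ℝ (1 : ℕ∞) g (ambient U) →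
        (∀ x : U, g (x : M) = φ.equiv x (hU x.2) (s.1 x)) →
        ∀ (x : U) (v : RSpace n), φ.equiv x (hU x.2) ((D.toHom U s).1 x v) =
          fderiv ℝ g (x : M) v - contract ω (x : M) (g (x : M)) v := by
  let e : Fin φ.rank → E.sections 1 φ.source := fun i =>
    ofCoord D.one_le hφ le_rfl (G := fun _ => Pi.single i 1) contDiffOn_const
  choose ω hω hωe using fun i => (D.toHom φ.source (e i)).2 φ hφ
  simp only [inf_idem] at hω
  -- For the frame `e` of constant coordinates, `∇ eᵢ` has coordinates `ω i`; the sign matches the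
  -- convention `∇ = d - ω`.
  refine ⟨fun i x => -ω i x, fun i => (hω i).continuousOn.neg, ?_⟩
  intro U hU s g hg hgs x v
  have hgi : ∀ i, ContDiffOn ℝ (1 : ℕ∞) (fun y => g y i) (ambient U) := fun i =>
    contDiffOn_pi.1 hg i
  have hs : s = ∑ i, mulSection (fun y => g y i) (hgi i) (restrict hU (e i)) := by
    refine Subtype.ext (funext fun y => (φ.equiv y (hU y.2)).injective ?_)
    rw [← hgs y, AddSubmonoidClass.coe_finsetSum, Finset.sum_apply, map_sum]
    simp only [mulSection, restrict, e, ofCoord, map_smul, LinearEquiv.apply_symm_apply]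
    exact pi_eq_sum_univ' _
  have hd : HasFDerivAt g (fderiv ℝ g (x : M)) (x : M) :=
    ((hg.differentiableOn (by simp)).differentiableAt
      ((isOpen_ambient U).mem_nhds (mem_ambient.2 x.2))).hasFDerivAt
  have hfi : ∀ i, fderiv ℝ (fun y => g y i) (x : M) v = fderiv ℝ g (x : M) v i := by
    intro i
    rw [(hasFDerivAt_pi'.1 hd i).fderiv]
    rfl
  have h1 : (D.toHom U s).1 x v = ∑ i, (fderiv ℝ g (x : M) v i • (e i).1 ⟨x, hU x.2⟩ +
      g (x : M) i • (D.toHom φ.source (e i)).1 ⟨x, hU x.2⟩ v) := by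
    conv_lhs => rw [hs]
    rw [map_sum, AddSubmonoidClass.coe_finsetSum, Finset.sum_apply, LinearMap.sum_apply]
    refine Finset.sum_congr rfl fun i _ => ?_
    rw [D.leibniz, hfi, D.natural]
    rfl
  rw [h1, map_sum]
  have lin : ∀ (a b : ℝ) (y z : E.Fiber x) (y' z' : Fin φ.rank → ℝ),
      φ.equiv x (hU x.2) y = y' → φ.equiv x (hU x.2) z = z' →
      φ.equiv x (hU x.2) (a • y + b • z) = a • y' + b • z' := by
    rintro a b y z _ _ rfl rfl
    rw [map_add, map_smul, map_smul]
  have h2 : ∀ i, φ.equiv x (hU x.2) (fderiv ℝ g (x : M) v i • (e i).1 ⟨x, hU x.2⟩ +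
      g (x : M) i • (D.toHom φ.source (e i)).1 ⟨x, hU x.2⟩ v) =
      fderiv ℝ g (x : M) v i • (Pi.single i 1 : Fin φ.rank → ℝ) + g (x : M) i • ω i (x : M) v := by
    intro i
    have h3 : φ.equiv x (hU x.2) ((e i).1 ⟨x, hU x.2⟩) = Pi.single i 1 :=
      LinearEquiv.apply_symm_apply _ _
    have h4 : φ.equiv x (hU x.2) ((D.toHom φ.source (e i)).1 ⟨x, hU x.2⟩ v) = ω i (x : M) v :=
      (hωe i ⟨x, hU x.2⟩ (hU x.2) v).symm
    exact lin _ _ _ _ _ _ h3 h4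
  simp only [h2]
  rw [Finset.sum_add_distrib, ← pi_eq_sum_univ']
  simp [contract, sub_eq_add_neg, sum_apply]

/-- Parallel sections off a set with dense complement that extend locally extend globally. -/
theorem isNegligible_of_locally {F : Closeds M} (hF : Dense (F : Set M)ᶜ)
    (h : ∀ s ∈ D.parallel F.compl, ∀ x ∈ F, ∃ W : Opens M, x ∈ W ∧ ∃ t ∈ D.parallel W,
      ∀ (y : M) (hW : y ∈ W) (hy : y ∈ F.compl), t.1 ⟨y, hW⟩ = s.1 ⟨y, hy⟩) :
    D.IsNegligible F := by
  intro s hs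
  have h' : ∀ x : M, ∃ W : Opens M, x ∈ W ∧ ∃ t ∈ D.parallel W,
      ∀ (y : M) (hW : y ∈ W) (hy : y ∈ F.compl), t.1 ⟨y, hW⟩ = s.1 ⟨y, hy⟩ := by
    intro x
    by_cases hx : x ∈ F
    · exact h s hs x hx
    · exact ⟨F.compl, hx, s, hs, fun _ _ _ => rfl⟩
  choose W hxW t ht hts using h'
  -- At each point, `T` takes the value of the extension chosen at that point; density shows that it
  -- agrees with `t x` on all of `W x`.
  let T : ∀ x : (⊤ : Opens M), E.Fiber x := fun x => (t x).1 ⟨x, hxW x⟩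
  have hT : ∀ x (y : W x), T ⟨y, trivial⟩ = (t x).1 y := fun x y =>
    sections_eq_of_dense (t y) (t x) hF (fun z h₁ h₂ hz => (hts y z h₁ hz).trans (hts x z h₂ hz).symm)
      y (hxW y) y.2
  have hTm : T ∈ E.sections 1 ⊤ := mem_sections_of_locally fun x =>
    ⟨W x, le_top, hxW x, by
      have : (fun y : W x => T ⟨y, trivial⟩) = (t x).1 := funext (hT x)
      exact this ▸ (t x).2⟩
  refine ⟨⟨T, hTm⟩, ?_, ?_⟩
  · refine Subtype.ext (funext fun x => ?_)
    have hr : restrict le_top ⟨T, hTm⟩ = t x := Subtype.ext (funext (hT x))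
    have h0 : restrictForm le_top (D.toHom ⊤ ⟨T, hTm⟩) = (0 : E.formSections 0 (W x)) :=
      (D.natural ⊤ (W x) le_top ⟨T, hTm⟩).symm.trans ((congrArg _ hr).trans (ht x))
    exact congrFun (congrArg Subtype.val h0) ⟨x, hxW x⟩
  · exact Subtype.ext (funext fun x => hts x x (hxW x) x.2)

end Connection

end Bundles

/-! ### Thin sets of large measure. -/

section Fat

variable {n : ℕ}

/-- Locally, `F` is contained in a power of a closed subset of `ℝ` with dense complement. -/
def LocallyThin (F : Set (RSpace n)) : Prop :=
  ∀ x ∈ F, ∃ U : Set (RSpace n), IsOpen U ∧ x ∈ U ∧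
    ∃ K : Set ℝ, IsClosed K ∧ Dense Kᶜ ∧ Disjoint (F ∩ U) (powCompl n K)

theorem volume_hyperplane (i : Fin n) (c : ℝ) : volume {x : RSpace n | x i = c} = 0 := by
  have h := (EuclideanSpace.volume_preserving_symm_measurableEquiv_toLp (Fin n))
  have := h.measure_preimage_equiv {x : Fin n → ℝ | x i = c}
  rw [volume_pi, Measure.pi_hyperplane] at this
  exact this

/-- A set of finite measure is contained in a closed nowhere dense power up to a small set. -/
theorem exists_powCompl_inter_lt {C : Set (RSpace n)} (hC : volume C ≠ ∞) {ε : ℝ≥0∞}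
    (hε : ε ≠ 0) :
    ∃ K : Set ℝ, IsClosed K ∧ Dense Kᶜ ∧ volume (C ∩ powCompl n K) < ε := by
  let μ : Measure (RSpace n) := volume.restrict C
  have : IsFiniteMeasure μ := ⟨by simpa [μ] using hC.lt_top⟩
  -- The `ν`-measure of an open `U` is the sum of the volumes in `C` of the slabs `x i ∈ U`, whose
  -- union is `powCompl n Uᶜ`. Hyperplanes are null, hence so is `ℚ`, and outer regularity supplies
  -- a small `U ⊇ ℚ`.
  let ν : Measure ℝ := ∑ i : Fin n, μ.map (fun x : RSpace n => x i)
  have hm : ∀ i : Fin n, Measurable (fun x : RSpace n => x i) := fun i => by fun_prop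
  have hν : ∀ s, MeasurableSet s → ν s = ∑ i : Fin n, μ ((fun x : RSpace n => x i) ⁻¹' s) := by
    intro s hs
    simp only [ν, Measure.finsetSum_apply]
    exact Finset.sum_congr rfl fun i _ => Measure.map_apply (hm i) hs
  have h0 : ν (Set.range ((↑) : ℚ → ℝ)) = 0 := by
    rw [← Set.biUnion_of_singleton (Set.range _),
      measure_biUnion_null_iff (Set.countable_range _)]
    intro q _
    rw [hν _ (measurableSet_singleton q)]
    refine Finset.sum_eq_zero fun i _ => ?_
    exact Measure.restrict_le_self.absolutelyContinuous (volume_hyperplane i q)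
  obtain ⟨U, hQU, hU, hlt⟩ := Set.exists_isOpen_lt_of_lt (μ := ν) (Set.range ((↑) : ℚ → ℝ)) ε
    (by rw [h0]; exact hε.bot_lt)
  refine ⟨Uᶜ, hU.isClosed_compl, by
    rw [compl_compl]; exact Rat.denseRange_cast.mono hQU, lt_of_le_of_lt ?_ hlt⟩
  rw [hν U hU.measurableSet]
  refine le_trans ?_ (measure_iUnion_fintype_le μ fun i => (fun x : RSpace n => x i) ⁻¹' U)
  rw [Set.inter_comm]
  refine (Measure.le_restrict_apply _ _).trans (measure_mono fun x hx => ?_)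
  simpa [powCompl] using hx

/-- Inner regularity gives a compact set whose volume exceeds `a` by more than some `r > 0`;
removing the open set `powCompl n K` costs less than `r` and keeps compactness. -/
theorem exists_isCompact_locallyThin {M : Set (RSpace n)} (hM : IsOpen M) {a : ℝ≥0∞}
    (ha : a < volume M) :
    ∃ F ⊆ M, IsCompact F ∧ a < volume F ∧
      ∃ K : Set ℝ, IsClosed K ∧ Dense Kᶜ ∧ Disjoint F (powCompl n K) := by
  obtain ⟨C, hCM, hC, haC⟩ := hM.exists_lt_isCompact ha
  obtain ⟨r, hr, har⟩ := ENNReal.lt_iff_exists_add_pos_lt.1 haC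
  obtain ⟨K, hK, hKd, hlt⟩ := exists_powCompl_inter_lt hC.measure_ne_top
    (ENNReal.coe_ne_zero.2 hr.ne')
  refine ⟨C \ powCompl n K, Set.sdiff_subset.trans hCM, hC.diff (isOpen_powCompl hK), ?_,
    K, hK, hKd, Set.disjoint_sdiff_left⟩
  by_contra! h
  have := measure_le_inter_add_sdiff volume C (powCompl n K)
  have h2 : volume C ≤ r + a := this.trans (add_le_add hlt.le h)
  rw [add_comm] at h2
  exact absurd har h2.not_gt

/-- The annuli exhaust the space up to null spheres and meet `M` in finite volume. A thin compact
set with at least half of that volume is kept in each; the halves still sum to infinity. Local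
finiteness makes the union closed, and since the annuli are open and disjoint, each sees a single
piece and its own `K i`. -/
theorem exists_isClosed_locallyThin (hn : 0 < n) {M : Set (RSpace n)} (hM : IsOpen M)
    (hMv : volume M = ∞) :
    ∃ F ⊆ M, IsClosed F ∧ volume F = ∞ ∧ LocallyThin F := by
  have : Nonempty (Fin n) := ⟨⟨0, hn⟩⟩
  let A : ℕ → Set (RSpace n) := fun i => {x | (i : ℝ) < ‖x‖ ∧ ‖x‖ < i + 1}
  have hAo : ∀ i, IsOpen (A i) := fun i =>
    (isOpen_lt continuous_const continuous_norm).inter (isOpen_lt continuous_norm continuous_const)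
  have hAfl : ∀ i, ∀ x ∈ A i, ⌊‖x‖⌋₊ = i := fun i x hx =>
    (Nat.floor_eq_iff (norm_nonneg x)).2 ⟨hx.1.le, hx.2⟩
  have hAd : ∀ i j x, x ∈ A i → x ∈ A j → i = j := fun i j x hi hj => by
    rw [← hAfl i x hi, hAfl j x hj]
  have hfin : ∀ i, volume (M ∩ A i) ≠ ∞ := fun i =>
    ((measure_mono fun x hx => mem_ball_zero_iff.2 hx.2.2).trans_lt
      (measure_ball_lt_top (x := (0 : RSpace n)) (r := (i : ℝ) + 1))).ne
  have hsum : ∑' i, volume (M ∩ A i) = ∞ := by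
    rw [← top_le_iff, ← hMv]
    have hcov : M ⊆ (⋃ i, M ∩ A i) ∪ ⋃ i : ℕ, sphere (0 : RSpace n) i := by
      intro x hx
      have h1 := Nat.floor_le (norm_nonneg x)
      have h2 := Nat.lt_floor_add_one ‖x‖
      rcases h1.lt_or_eq with h | h
      · exact Or.inl (Set.mem_iUnion.2 ⟨_, hx, h, h2⟩)
      · exact Or.inr (Set.mem_iUnion.2 ⟨_, mem_sphere_zero_iff_norm.2 h.symm⟩)
    have hnull : volume (⋃ i : ℕ, sphere (0 : RSpace n) i) = 0 :=
      measure_iUnion_null fun i => Measure.addHaar_sphere _ _ _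
    calc volume M ≤ _ := measure_mono hcov
      _ ≤ _ := measure_union_le _ _
      _ = volume (⋃ i, M ∩ A i) := by rw [hnull, add_zero]
      _ ≤ _ := measure_iUnion_le _
  have hex : ∀ i, ∃ F ⊆ M ∩ A i, IsCompact F ∧ volume (M ∩ A i) / 2 ≤ volume F ∧
      ∃ K : Set ℝ, IsClosed K ∧ Dense Kᶜ ∧ Disjoint F (powCompl n K) := by
    intro i
    -- A null piece has no volume strictly below its own, so the empty set is used there.
    by_cases h : volume (M ∩ A i) = 0
    · exact ⟨∅, Set.empty_subset _, isCompact_empty, by simp [h], ∅, isClosed_empty, by simp,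
        by simp⟩
    · obtain ⟨F, h1, h2, h3, h4⟩ := exists_isCompact_locallyThin (hM.inter (hAo i))
        (ENNReal.half_lt_self h (hfin i))
      exact ⟨F, h1, h2, h3.le, h4⟩
  choose F hF hFc hFv K hK hKd hFK using hex
  have hlf : LocallyFinite F := by
    intro x
    refine ⟨ball 0 (‖x‖ + 1), isOpen_ball.mem_nhds (by simp), ?_⟩
    refine (Set.finite_Iio (⌈‖x‖ + 1⌉₊)).subset ?_
    rintro i ⟨y, hy, hyb⟩
    have h1 := (hF i hy).2.1
    have h2 := mem_ball_zero_iff.1 hyb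
    exact Nat.lt_ceil.2 (h1.trans h2)
  refine ⟨⋃ i, F i, Set.iUnion_subset fun i => (hF i).trans Set.inter_subset_left,
    hlf.isClosed_iUnion fun i => (hFc i).isClosed, ?_, ?_⟩
  · rw [measure_iUnion (fun i j hij => Set.disjoint_left.2 fun x hi hj =>
      hij (hAd i j x (hF i hi).2 (hF j hj).2)) fun i => (hFc i).measurableSet, ← top_le_iff]
    calc (∞ : ℝ≥0∞) = ∑' i, volume (M ∩ A i) / 2 := by
          simp only [div_eq_mul_inv]
          rw [ENNReal.tsum_mul_right, hsum, ENNReal.top_mul (by simp)]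
      _ ≤ _ := ENNReal.tsum_le_tsum hFv
  · intro x hx
    obtain ⟨i, hi⟩ := Set.mem_iUnion.1 hx
    refine ⟨A i, hAo i, (hF i hi).2, K i, hK i, hKd i, Set.disjoint_left.2 ?_⟩
    rintro y ⟨hy, hyA⟩
    obtain ⟨j, hj⟩ := Set.mem_iUnion.1 hy
    obtain rfl := hAd i j y hyA (hF j hj).2
    exact Set.disjoint_left.1 (hFK i) hj

end Fat

/-! ### Locally thin sets are negligible. -/

section Main

variable {n : ℕ}

theorem LocallyThin.dense_compl (hn : 0 < n) {M : Opens (RSpace n)} {F : Set M}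
    (hF : LocallyThin (Subtype.val '' F)) : Dense Fᶜ := by
  refine dense_iff_inter_open.2 fun O hO ⟨x, hx⟩ => ?_
  by_cases hxF : x ∈ F
  · obtain ⟨U, hU, hxU, K, -, hK, hd⟩ := hF x (Set.mem_image_of_mem _ hxF)
    obtain ⟨_, ⟨⟨y, hyO, rfl⟩, hyU⟩, hyK⟩ := (dense_powCompl hn hK).inter_open_nonempty
      (ambient ⟨O, hO⟩ ∩ U) ((isOpen_ambient _).inter hU) ⟨x, Set.mem_image_of_mem _ hx, hxU⟩
    exact ⟨y, hyO, fun hyF => Set.disjoint_left.1 hd ⟨Set.mem_image_of_mem _ hyF, hyU⟩ hyK⟩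
  · exact ⟨x, hx, hxF⟩

/-- Around a point of `F`, the coordinates of a parallel section solve the linear equation off `K ^
n`; the extended solution gives the local parallel section required for gluing. -/
theorem Connection.isNegligible_of_locallyThin (hn : 2 ≤ n) {M : Opens (RSpace n)} {l : ℕ∞}
    {E : VectBundle.{u} M l} (D : Connection E) {F : Closeds M}
    (hF : LocallyThin (Subtype.val '' (F : Set M))) : D.IsNegligible F := by
  refine D.isNegligible_of_locally (hF.dense_compl (by omega)) fun s hs x hx => ?_
  obtain ⟨U, hU, hxU, K, -, hK, hd⟩ := hF x (Set.mem_image_of_mem _ hx)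
  obtain ⟨φ, hφ, hxφ⟩ := E.cover x
  obtain ⟨ω, hω, hD⟩ := D.exists_local_form hφ
  obtain ⟨g, hg, hgs⟩ := s.2 φ hφ
  have hgood : ∀ y : M, (y : RSpace n) ∈ U → (y : RSpace n) ∈ powCompl n K → y ∈ F.compl :=
    fun y hyU hyK hyF => Set.disjoint_left.1 hd ⟨Set.mem_image_of_mem _ hyF, hyU⟩ hyK
  have hder : ∀ y ∈ (ambient φ.source ∩ U) ∩ powCompl n K,
      HasFDerivAt g (contract ω y (g y)) y := by
    rintro _ ⟨⟨⟨y, hyφ, rfl⟩, hyU⟩, hyK⟩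
    have hyF := hgood y hyU hyK
    have hd : HasFDerivAt g (fderiv ℝ g (y : RSpace n)) (y : RSpace n) :=
      ((hg.differentiableOn (by simp)).differentiableAt
        ((isOpen_ambient _).mem_nhds (mem_ambient.2 ⟨hyF, hyφ⟩))).hasFDerivAt
    have hle : F.compl ⊓ φ.source ≤ F.compl := inf_le_left
    have h0 : D.toHom _ (VectBundle.restrict hle s) = 0 := by
      rw [D.natural, show D.toHom F.compl s = 0 from hs]
      rfl
    have heq : fderiv ℝ g (y : RSpace n) = contract ω y (g y) := by
      ext1 v
      have h1 := hD (F.compl ⊓ φ.source) inf_le_right (VectBundle.restrict hle s) g hg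
        (fun z => hgs ⟨z, z.2.1⟩ z.2.2) ⟨y, hyF, hyφ⟩ v
      rw [h0] at h1
      exact sub_eq_zero.1 (h1.symm.trans (map_zero (φ.equiv y hyφ)))
    rwa [heq] at hd
  obtain ⟨ρ, hρ, hsub, G, hG, hGd, hGg⟩ := exists_extension_of_powCompl hn hK
    ((isOpen_ambient φ.source).inter hU) (x₀ := x) ⟨mem_ambient.2 hxφ, hxU⟩
    (fun i => (hω i).mono Set.inter_subset_left) hder
  let W : Opens M := ⟨Subtype.val ⁻¹' ball (x : RSpace n) ρ,
    isOpen_ball.preimage continuous_subtype_val⟩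
  have hWb : ambient W ⊆ ball (x : RSpace n) ρ := by
    rintro _ ⟨y, hy, rfl⟩
    exact hy
  have hWφ : W ≤ φ.source := fun y hy => mem_ambient.1 (hsub hy).1
  have hGW : ContDiffOn ℝ (1 : ℕ∞) G (ambient W) := hG.mono hWb
  refine ⟨W, mem_ball_self hρ, VectBundle.ofCoord D.one_le hφ hWφ hGW, ?_, ?_⟩
  · refine Subtype.ext (funext fun y => LinearMap.ext fun v => ?_)
    refine (φ.equiv y (hWφ y.2)).injective ?_
    refine (hD W hWφ _ G hGW (fun z => (LinearEquiv.apply_symm_apply _ _).symm) y v).trans ?_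
    rw [(hGd _ y.2).fderiv, sub_self]
    exact (map_zero (φ.equiv y (hWφ y.2))).symm
  · intro y hyW hyF
    have hO : IsOpen (ambient (W ⊓ F.compl)) := isOpen_ambient _
    have hO' : ambient (W ⊓ F.compl) ⊆ ambient (F.compl ⊓ φ.source) :=
      Set.image_mono fun z hz => ⟨hz.2, hWφ hz.1⟩
    -- `F` may be smaller than `K ^ n` near `x`: at points of `K ^ n` outside `F`, `G` and `g` agree
    -- only by continuity and density.
    have heq : Set.EqOn G g (ambient (W ⊓ F.compl) ∩ powCompl n K) := fun z hz =>
      hGg ⟨hWb (Set.image_mono (fun _ h => h.1) hz.1), hz.2⟩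
    have hGy := heq.of_subset_closure
      (hGW.continuousOn.mono (Set.image_mono fun _ h => h.1)) (hg.continuousOn.mono hO')
      Set.inter_subset_left ((dense_powCompl (by omega) hK).open_subset_closure_inter hO)
      (mem_ambient.2 ⟨hyW, hyF⟩ : (y : RSpace n) ∈ ambient (W ⊓ F.compl))
    refine (φ.equiv y (hWφ hyW)).injective ?_
    refine (LinearEquiv.apply_symm_apply _ _).trans ?_
    exact hGy.trans (hgs ⟨y, hyF⟩ (hWφ hyW))

theorem isNegligibleForClass_of_locallyThin (hn : 2 ≤ n) (k m : ℕ∞) {M : Opens (RSpace n)}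
    {F : Closeds M} (hF : LocallyThin (Subtype.val '' (F : Set M))) :
    IsNegligibleForClass.{u} k m M F :=
  fun _ _ _ D _ => D.isNegligible_of_locallyThin hn hF

end Main

end ParallelExtension

theorem mainTheorem4 (n : ℕ) (hn : 2 ≤ n) (k : ℕ∞) (hk : 1 ≤ k)
    (M : TopologicalSpace.Opens (EuclideanSpace ℝ (Fin n))) :
    (∀ lam0 : ℝ,
      (lam0 : EReal) < ((MeasureTheory.volume (M : Set (EuclideanSpace ℝ (Fin n))) : ℝ≥0∞) : EReal) →
      ∃ F : TopologicalSpace.Closeds M, IsCompact (F : Set M) ∧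
        (lam0 : EReal) < ((MeasureTheory.volume
          (Subtype.val '' (F : Set M) : Set (EuclideanSpace ℝ (Fin n))) : ℝ≥0∞) : EReal) ∧
        ParallelExtension.IsNegligibleForClass.{u} k 0 M F) ∧
    (MeasureTheory.volume (M : Set (EuclideanSpace ℝ (Fin n))) = ⊤ →
      ∃ F : TopologicalSpace.Closeds M,
        MeasureTheory.volume
          (Subtype.val '' (F : Set M) : Set (EuclideanSpace ℝ (Fin n))) = ⊤ ∧
        ParallelExtension.IsNegligibleForClass.{u} k 0 M F) := by
  have himage : ∀ F : Set (EuclideanSpace ℝ (Fin n)), F ⊆ M →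
      (Subtype.val '' (Subtype.val ⁻¹' F : Set M)) = F := fun F hF =>
    Set.image_preimage_eq_of_subset fun x hx => ⟨⟨x, hF hx⟩, rfl⟩
  refine ⟨fun lam0 hlam => ?_, fun hM => ?_⟩
  -- For negative `lam0` the empty set works; this case is separate because `ENNReal.ofReal`
  -- truncates negative numbers to 0.
  · rcases lt_or_ge lam0 0 with h0 | h0
    · refine ⟨⊥, by simp, ?_, ParallelExtension.isNegligibleForClass_of_locallyThin hn k 0 ?_⟩
      · simpa using h0
      · rintro x ⟨y, hy, -⟩
        exact hy.elim
    · have hcoe : (lam0 : EReal) = ((ENNReal.ofReal lam0 : ℝ≥0∞) : EReal) := by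
        rw [EReal.coe_ennreal_ofReal, max_eq_left h0]
      rw [hcoe] at hlam ⊢
      obtain ⟨F, hFM, hFc, hlt, K, hK, hKd, hd⟩ :=
        ParallelExtension.exists_isCompact_locallyThin M.isOpen
          (EReal.coe_ennreal_lt_coe_ennreal_iff.1 hlam)
      refine ⟨⟨Subtype.val ⁻¹' F, hFc.isClosed.preimage continuous_subtype_val⟩, ?_, ?_,
        ParallelExtension.isNegligibleForClass_of_locallyThin hn k 0 ?_⟩
      · rw [Subtype.isCompact_iff]
        exact (himage F hFM).symm ▸ hFc
      · exact EReal.coe_ennreal_lt_coe_ennreal_iff.2 ((himage F hFM).symm ▸ hlt)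
      · change ParallelExtension.LocallyThin (Subtype.val '' (Subtype.val ⁻¹' F : Set M))
        rw [himage F hFM]
        exact fun x _ => ⟨Set.univ, isOpen_univ, trivial, K, hK, hKd,
          hd.mono_left Set.inter_subset_left⟩
  · obtain ⟨F, hFM, hFc, hv, hF⟩ :=
      ParallelExtension.exists_isClosed_locallyThin (by omega) M.isOpen hM
    refine ⟨⟨Subtype.val ⁻¹' F, hFc.preimage continuous_subtype_val⟩, ?_,
      ParallelExtension.isNegligibleForClass_of_locallyThin hn k 0 ?_⟩
    · exact (himage F hFM).symm ▸ hv
    · exact (himage F hFM).symm ▸ hF
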